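/- Let $R$ be a commutative Noetherian local ring which is Gorenstein (that is, $R$ has finite injective dimension as a module over itself), and let $d=\dim R$ be its Krull dimension. A finitely generated $R$-module is called maximal Cohen-Macaulay (MCM) if its depth is at least $d$ (the zero module has depth $\infty$). For an $R$-module $M$ let $\underline{\mathrm{ann}}_R M$ be the annihilator in $R$ of the stable endomorphism ring $\underline{\mathrm{End}}_R(M)=\mathrm{End}_R(M)/P(M,M)$, where $P(M,M)$ is the set of endomorphisms of $M$ that factor through a finitely generated projective $R$-module. For an MCM $R$-module $M$ and an integer $k\ge 1$ put $$\mathrm{cl}_k(M)=\{\,L \text{ an MCM } R\text{-module} : (\underline{\mathrm{ann}}_R L)^k\subseteq \underline{\mathrm{ann}}_R M\,\}.$$ An $R$-order is a (not necessarily commutative) $R$-algebra $\Lambda$ that is finitely generated and MCM as an $R$-module and has finite injective dimension as a left and as a right module over itself. "$\Lambda$-module" means left $\Lambda$-module. A finitely generated $\Lambda$-module $X$ belongs to $\mathrm{MCM}(\Lambda)$ if $\mathrm{Ext}^i_\Lambda(X,\Lambda)=0$ for all $i>0$; through the structure map $R\to\Lambda$ we also regard $X$ as an $R$-module. For an integer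 $n\ge 0$, the order $\Lambda$ is $n$-canonical if the $\Lambda$-module $\omega=\mathrm{Hom}_R(\Lambda,R)$, with action $(a f)(x)=f(xa)$, has projective dimension $n$. A Gorenstein order is a $0$-canonical order, and a nonsingular order is a Gorenstein order of finite global dimension. **Theorem.** Let $\Lambda$ be an $n$-canonical $R$-order and assume that the structure map $R\to\Lambda$ is a split monomorphism of $R$-modules. Then, for every MCM $R$-module $M$, $$\mathrm{MCM}(\Lambda)\cap \mathrm{cl}_{d+n+1}(M)\neq\emptyset ,$$ that is, there is $X\in\mathrm{MCM}(\Lambda)$ which is MCM as an $R$-module and satisfies $(\underline{\mathrm{ann}}_R X)^{d+n+1}\subseteq\underline{\mathrm{ann}}_R M$. In particular, if $\Lambda$ is a Gorenstein order, then $\mathrm{MCM}(\Lambda)\cap \mathrm{cl}_{d+1}(M)\neq\emptyset$, and if $\Lambda$ is a nonsingular order, then $\Lambda\in\mathrm{cl}_{d+1}(M)$. -/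

import Mathlib

universe u v w

namespace CohenMacaulayOrders

open CategoryTheory

section Commutative

variable (R : Type u) [CommRing R]

/-- The depth of a module over a local ring: the supremum of the lengths of the regular sequences
on `M` contained in the maximal ideal; the zero module has depth `∞`. (For `M` nonzero and finitely
generated over a Noetherian local ring the supremum is attained.) -/
noncomputable def depth [IsLocalRing R] (M : Type v) [AddCommGroup M] [Module R M] : ℕ∞ :=
  open Classical in
  if Subsingleton M then ⊤
  else ⨆ rs : {rs : List R //
      (∀ r ∈ rs, r ∈ IsLocalRing.maximalIdeal R) ∧ RingTheory.Sequence.IsRegular M rs},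
    (rs.1.length : ℕ∞)

/-- Maximal Cohen-Macaulay modules over a commutative local ring: finitely generated modules whose
depth is at least the Krull dimension of the ring. The zero module is included. -/
structure IsMCM [IsLocalRing R] (M : Type v) [AddCommGroup M] [Module R M] : Prop where
  finite : Module.Finite R M
  dim_le_depth : ringKrullDim R ≤ (depth R M : WithBot ℕ∞)

variable (M : Type v) [AddCommGroup M] [Module R M] (N : Type w) [AddCommGroup N] [Module R N]

/-- The submodule of `Hom_R(M, N)` of the maps that factor through a (finitely generated)
projective module. -/
def projectiveHom : Submodule R (M →ₗ[R] N) where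
  carrier := {f | ∃ (P : Type u) (_ : AddCommGroup P) (_ : Module R P),
    Module.Finite R P ∧ Module.Projective R P ∧
      ∃ (g : M →ₗ[R] P) (h : P →ₗ[R] N), f = h ∘ₗ g}
  zero_mem' := ⟨PUnit, inferInstance, inferInstance, inferInstance, inferInstance, 0, 0, by simp⟩
  add_mem' := by
    rintro _ _ ⟨P, _, _, _, _, g, h, rfl⟩ ⟨P', _, _, _, _, g', h', rfl⟩
    exact ⟨P × P', inferInstance, inferInstance, inferInstance, inferInstance,
      g.prod g', h.coprod h', by ext x; simp⟩
  smul_mem' := by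
    rintro r _ ⟨P, _, _, hP, hP', g, h, rfl⟩
    exact ⟨P, inferInstance, inferInstance, hP, hP', r • g, h, by ext x; simp⟩

/-- The stable Hom-module `Hom_R(M, N) / P(M, N)`. -/
abbrev StableHom : Type (max v w) := (M →ₗ[R] N) ⧸ projectiveHom R M N

/-- The stable annihilator of `M`: the annihilator of its stable endomorphism ring. -/
def stableAnnihilator : Ideal R := Module.annihilator R (StableHom R M M)

/-- `L ∈ cl_k(M)`: the module `L` is maximal Cohen-Macaulay over `R` and the `k`-th power of its
stable annihilator is contained in the stable annihilator of `M`. -/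
structure MemCl [IsLocalRing R] (k : ℕ) (L : Type w) [AddCommGroup L] [Module R L] : Prop where
  isMCM : IsMCM R L
  pow_le : stableAnnihilator R L ^ k ≤ stableAnnihilator R M

end Commutative

/-- The left `A`-module `M` has finite injective dimension. -/
def HasFiniteInjectiveDimension (A : Type u) [Ring A] (M : Type u) [AddCommGroup M] [Module A M] :
    Prop :=
  ∃ n : ℕ, HasInjectiveDimensionLE (ModuleCat.of A M) n

/-- A local ring is Gorenstein if it is Noetherian and has finite injective dimension as a module
over itself. -/
structure IsGorensteinLocalRing (R : Type u) [CommRing R] : Prop where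
  isLocalRing : IsLocalRing R
  isNoetherianRing : IsNoetherianRing R
  finite_injectiveDimension : HasFiniteInjectiveDimension R R

/-- Finite (left) global dimension. -/
def HasFiniteGlobalDimension (A : Type u) [Ring A] : Prop :=
  ∃ n : ℕ, ∀ X : ModuleCat.{u} A, HasProjectiveDimensionLE X n

/-- Maximal Cohen-Macaulay left modules over a (not necessarily commutative) ring `A`: finitely
generated modules `X` with `Ext_A^i(X, A) = 0` for all `i > 0`. -/
structure IsMCMLeft (A : Type u) [Ring A] (X : Type u) [AddCommGroup X] [Module A X] : Prop where
  finite : Module.Finite A X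
  ext_eq_zero : ∀ i : ℕ, 0 < i →
    Subsingleton (Abelian.Ext (ModuleCat.of A X) (ModuleCat.of A A) i)

section Orders

variable (R : Type u) [CommRing R] (Λ : Type u) [Ring Λ] [Algebra R Λ]

/-- An `R`-order is a module-finite `R`-algebra which is maximal Cohen-Macaulay as an `R`-module and
which has finite injective dimension as a left and as a right module over itself. -/
structure IsOrder [IsLocalRing R] : Prop where
  isMCM : IsMCM R Λ
  left_injectiveDimension : HasFiniteInjectiveDimension Λ Λ
  right_injectiveDimension : HasFiniteInjectiveDimension Λᵐᵒᵖ Λ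

/-- The canonical module `ω = Hom_R(Λ, R)` of an algebra over a Gorenstein local ring `R`. -/
def CanonicalModule : Type u := Λ →ₗ[R] R

noncomputable instance CanonicalModule.instAddCommGroup : AddCommGroup (CanonicalModule R Λ) :=
  inferInstanceAs (AddCommGroup (Λ →ₗ[R] R))

/-- The left `Λ`-module structure on `ω`, given by `(a • f) x = f (x * a)`. -/
noncomputable instance CanonicalModule.instModule : Module Λ (CanonicalModule R Λ) where
  smul a f := LinearMap.comp (show Λ →ₗ[R] R from f) (LinearMap.mulRight R a)
  one_smul f := LinearMap.ext fun x => congrArg (show Λ →ₗ[R] R from f) (mul_one x)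
  mul_smul a b f := LinearMap.ext fun x =>
    congrArg (show Λ →ₗ[R] R from f) (mul_assoc x a b).symm
  smul_zero _ := rfl
  zero_smul f := LinearMap.ext fun x =>
    (congrArg (show Λ →ₗ[R] R from f) (mul_zero x)).trans (map_zero _)
  smul_add _ _ _ := rfl
  add_smul a b f := LinearMap.ext fun x =>
    (congrArg (show Λ →ₗ[R] R from f) (mul_add x a b)).trans (map_add _ _ _)

/-- An `n`-canonical order: its canonical module has projective dimension exactly `n` over `Λ`. -/
structure IsCanonicalOrder [IsLocalRing R] (n : ℕ) : Prop extends IsOrder R Λ where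
  projectiveDimension_eq :
    projectiveDimension (ModuleCat.of Λ (CanonicalModule R Λ)) = (n : WithBot ℕ∞)

/-- A Gorenstein order is a `0`-canonical order. -/
def IsGorensteinOrder [IsLocalRing R] : Prop := IsCanonicalOrder R Λ 0

/-- A nonsingular order is a Gorenstein order of finite global dimension. -/
structure IsNonsingularOrder [IsLocalRing R] : Prop where
  isGorensteinOrder : IsGorensteinOrder R Λ
  finite_globalDimension : HasFiniteGlobalDimension Λ

/-- The structure map `R → Λ` is a split monomorphism of `R`-modules. -/
def IsSplitStructureMap : Prop :=
  ∃ s : Λ →ₗ[R] R, s ∘ₗ Algebra.linearMap R Λ = LinearMap.id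

/-- `MCM(Λ) ∩ cl_k(M) ≠ ∅`: there is a maximal Cohen-Macaulay `Λ`-module whose underlying
`R`-module (obtained by restriction along `R → Λ`) lies in `cl_k(M)`. -/
def MCMMeetsCl [IsLocalRing R] (k : ℕ) (M : Type u) [AddCommGroup M] [Module R M] : Prop :=
  ∃ (X : Type u) (_ : AddCommGroup X) (_ : Module R X) (_ : Module Λ X) (_ : IsScalarTower R Λ X),
    IsMCMLeft Λ X ∧ MemCl R M k X

end Orders

end CohenMacaulayOrders

/-! The module `Λ ⊗ M` is a finitely generated `Λ`-module that has `M` as an `R`-summand. Let `X` be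
its `(d+n)`-th syzygy over `Λ`; the required module is `X × Λ`.

Annihilators: `Λ` need not be `R`-projective, but its stable annihilator kills `Ext_R^i(Λ^m, -)` for
`i > 0`. Each of the `d+n` dimension shifts therefore costs one factor from `Λ`, and `X` contributes
a last one, which kills `Ext_R^1(X, -)`. The product kills `Ext_R^(d+n+1)(M, W)`. For `W` the
`(d+n+1)`-st syzygy of `M` this means lying in the stable annihilator of `M`, since `Ext_R^i(M, R) =
0` for `i > 0` (`exists_syzygy`, `IsExtAcyclic.exists_extAnnihilator_le`).

Membership in `MCM(Λ)`: `R` has injective dimension at most `d`, so `d` syzygies yield a module with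
`Ext_R^i(-, R) = 0` for `i > 0`. Relative to such modules `ω` is injective and cogenerates. As `ω`
has projective dimension `n` and `Λ` has finite injective dimension, the relative injective
dimension of `Λ` is at most `n` (`IsExtAcyclic.extVanishes_of_canonicalModule`), so `n` further
syzygies suffice. -/

namespace CohenMacaulayOrders

open CategoryTheory Abelian

/-! ### Vanishing of Ext in short exact sequences. -/

section ExtVanishing

variable (A : Type u) [Ring A]

/-- The vanishing of the group `Ext_A^i(X, Y)`. -/
def ExtVanishes (X Y : Type u) [AddCommGroup X] [Module A X] [AddCommGroup Y] [Module A Y]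
    (i : ℕ) : Prop :=
  Subsingleton (Ext (ModuleCat.of A X) (ModuleCat.of A Y) i)

variable {A}
variable {X Y Z W : Type u} [AddCommGroup X] [Module A X] [AddCommGroup Y] [Module A Y]
  [AddCommGroup Z] [Module A Z] [AddCommGroup W] [Module A W]

theorem extVanishes_iff {i : ℕ} :
    ExtVanishes A X Y i ↔ ∀ e : Ext (ModuleCat.of A X) (ModuleCat.of A Y) i, e = 0 :=
  subsingleton_iff_forall_eq 0

theorem shortExact_of_linearMap {f : X →ₗ[A] Y} {g : Y →ₗ[A] Z} (hf : Function.Injective f)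
    (hfg : Function.Exact f g) (hg : Function.Surjective g) :
    (ModuleCat.shortComplexOfCompEqZero f g hfg.linearMap_comp_eq_zero).ShortExact :=
  ModuleCat.shortComplex_shortExact _ hfg hf hg

namespace ExtVanishes

theorem of_projective [Module.Projective A X] {i : ℕ} (hi : 0 < i) : ExtVanishes A X Y i := by
  obtain ⟨j, rfl⟩ := Nat.exists_eq_succ_of_ne_zero hi.ne'
  exact extVanishes_iff.mpr fun e => Ext.eq_zero_of_projective e

theorem of_hasInjectiveDimensionLE {t : ℕ} (h : HasInjectiveDimensionLE (ModuleCat.of A Y) t)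
    {i : ℕ} (hi : t < i) : ExtVanishes A X Y i :=
  HasInjectiveDimensionLT.subsingleton _ (t + 1) i hi _

theorem of_hasProjectiveDimensionLE {t : ℕ} (h : HasProjectiveDimensionLE (ModuleCat.of A X) t)
    {i : ℕ} (hi : t < i) : ExtVanishes A X Y i :=
  HasProjectiveDimensionLT.subsingleton _ (t + 1) i hi _

theorem of_retract_left {i : ℕ} (h : ExtVanishes A Y W i) (f : X →ₗ[A] Y) (g : Y →ₗ[A] X)
    (hgf : g ∘ₗ f = LinearMap.id) : ExtVanishes A X W i := by
  refine extVanishes_iff.mpr fun e => ?_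
  have hid : ModuleCat.ofHom f ≫ ModuleCat.ofHom g = 𝟙 (ModuleCat.of A X) := by
    rw [← ModuleCat.ofHom_comp, hgf, ModuleCat.ofHom_id]
  rw [← e.mk₀_id_comp, ← hid, ← Ext.mk₀_comp_mk₀_assoc,
    extVanishes_iff.mp h ((Ext.mk₀ (ModuleCat.ofHom g)).comp e (zero_add i)), Ext.comp_zero]

theorem of_retract_right {i : ℕ} (h : ExtVanishes A W Y i) (f : X →ₗ[A] Y) (g : Y →ₗ[A] X)
    (hgf : g ∘ₗ f = LinearMap.id) : ExtVanishes A W X i := by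
  refine extVanishes_iff.mpr fun e => ?_
  have hid : ModuleCat.ofHom f ≫ ModuleCat.ofHom g = 𝟙 (ModuleCat.of A X) := by
    rw [← ModuleCat.ofHom_comp, hgf, ModuleCat.ofHom_id]
  rw [← e.comp_mk₀_id, ← hid, ← Ext.mk₀_comp_mk₀, ← Ext.comp_assoc_of_third_deg_zero,
    extVanishes_iff.mp h (e.comp (Ext.mk₀ (ModuleCat.ofHom f)) (add_zero i)), Ext.zero_comp]

theorem of_linearEquiv_left {i : ℕ} (h : ExtVanishes A Y W i) (e : X ≃ₗ[A] Y) :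
    ExtVanishes A X W i :=
  h.of_retract_left e.toLinearMap e.symm.toLinearMap (by ext; simp)

theorem of_linearEquiv_right {i : ℕ} (h : ExtVanishes A W Y i) (e : X ≃ₗ[A] Y) :
    ExtVanishes A W X i :=
  h.of_retract_right e.toLinearMap e.symm.toLinearMap (by ext; simp)

section ShortExact

variable {f : X →ₗ[A] Y} {g : Y →ₗ[A] Z} (hf : Function.Injective f) (hfg : Function.Exact f g)
  (hg : Function.Surjective g)

include hf hfg hg

/-- In the names that follow, `right` and `left` tell which variable of Ext runs through the short
exact sequence; `first`, `middle`, `last` tell for which of its terms vanishing is concluded. -/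
theorem right_middle {i : ℕ} (h₁ : ExtVanishes A W X i) (h₃ : ExtVanishes A W Z i) :
    ExtVanishes A W Y i := by
  refine extVanishes_iff.mpr fun e => ?_
  obtain ⟨e', rfl⟩ := Ext.covariant_sequence_exact₂ _ (shortExact_of_linearMap hf hfg hg) e
    (extVanishes_iff.mp h₃ _)
  rw [extVanishes_iff.mp h₁ e', Ext.zero_comp]

theorem right_last {i : ℕ} (h₂ : ExtVanishes A W Y i) (h₁ : ExtVanishes A W X (i + 1)) :
    ExtVanishes A W Z i := by
  refine extVanishes_iff.mpr fun e => ?_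
  obtain ⟨e', rfl⟩ := Ext.covariant_sequence_exact₃ _ (shortExact_of_linearMap hf hfg hg) e rfl
    (extVanishes_iff.mp h₁ _)
  rw [extVanishes_iff.mp h₂ e', Ext.zero_comp]

theorem right_first {i : ℕ} (h₃ : ExtVanishes A W Z i) (h₂ : ExtVanishes A W Y (i + 1)) :
    ExtVanishes A W X (i + 1) := by
  refine extVanishes_iff.mpr fun e => ?_
  obtain ⟨e', rfl⟩ := Ext.covariant_sequence_exact₁ _ (shortExact_of_linearMap hf hfg hg) e
    (extVanishes_iff.mp h₂ _) rfl
  rw [extVanishes_iff.mp h₃ e', Ext.zero_comp]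

theorem left_middle {i : ℕ} (h₁ : ExtVanishes A X W i) (h₃ : ExtVanishes A Z W i) :
    ExtVanishes A Y W i := by
  refine extVanishes_iff.mpr fun e => ?_
  obtain ⟨e', rfl⟩ := Ext.contravariant_sequence_exact₂ (shortExact_of_linearMap hf hfg hg) _ e
    (extVanishes_iff.mp h₁ _)
  rw [extVanishes_iff.mp h₃ e', Ext.comp_zero]

theorem left_first {i : ℕ} (h₂ : ExtVanishes A Y W i) (h₃ : ExtVanishes A Z W (i + 1)) :
    ExtVanishes A X W i := by
  refine extVanishes_iff.mpr fun e => ?_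
  obtain ⟨e', rfl⟩ := Ext.contravariant_sequence_exact₁ (shortExact_of_linearMap hf hfg hg) _ e
    (add_comm 1 i) (extVanishes_iff.mp h₃ _)
  rw [extVanishes_iff.mp h₂ e', Ext.comp_zero]

theorem left_last {i : ℕ} (h₁ : ExtVanishes A X W i) (h₂ : ExtVanishes A Y W (i + 1)) :
    ExtVanishes A Z W (i + 1) := by
  refine extVanishes_iff.mpr fun e => ?_
  obtain ⟨e', rfl⟩ := Ext.contravariant_sequence_exact₃ (shortExact_of_linearMap hf hfg hg) _ e
    (extVanishes_iff.mp h₂ _) (add_comm 1 i)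
  rw [extVanishes_iff.mp h₁ e', Ext.comp_zero]

/-- If `Ext^1(Z, W) = 0`, then every map `X → W` extends to `Y`. -/
theorem exists_extension (h : ExtVanishes A Z W 1) (φ : X →ₗ[A] W) :
    ∃ ψ : Y →ₗ[A] W, ψ ∘ₗ f = φ := by
  obtain ⟨e, he⟩ := Ext.contravariant_sequence_exact₁ (shortExact_of_linearMap hf hfg hg) _
    (Ext.mk₀ (ModuleCat.ofHom φ)) (add_zero 1) (extVanishes_iff.mp h _)
  obtain ⟨ψ, rfl⟩ := Ext.homEquiv₀.symm.surjective e
  refine ⟨ψ.hom, ?_⟩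
  rw [Ext.homEquiv₀_symm_apply, Ext.mk₀_comp_mk₀] at he
  exact congrArg ModuleCat.Hom.hom ((Ext.mk₀_bijective _ _).1 he)

/-- If `Ext^1(W, X) = 0`, then every map `W → Z` lifts to `Y`. -/
theorem exists_lift (h : ExtVanishes A W X 1) (φ : W →ₗ[A] Z) :
    ∃ ψ : W →ₗ[A] Y, g ∘ₗ ψ = φ := by
  obtain ⟨e, he⟩ := Ext.covariant_sequence_exact₃ _ (shortExact_of_linearMap hf hfg hg)
    (Ext.mk₀ (ModuleCat.ofHom φ)) (zero_add 1) (extVanishes_iff.mp h _)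
  obtain ⟨ψ, rfl⟩ := Ext.homEquiv₀.symm.surjective e
  refine ⟨ψ.hom, ?_⟩
  rw [Ext.homEquiv₀_symm_apply, Ext.mk₀_comp_mk₀] at he
  exact congrArg ModuleCat.Hom.hom ((Ext.mk₀_bijective _ _).1 he)

/-- If every map `X → W` extends to `Y` and `Ext^1(Y, W) = 0`, then `Ext^1(Z, W) = 0`. -/
theorem one_of_exists_extension (h : ∀ φ : X →ₗ[A] W, ∃ ψ : Y →ₗ[A] W, ψ ∘ₗ f = φ)
    (h₂ : ExtVanishes A Y W 1) : ExtVanishes A Z W 1 := by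
  refine extVanishes_iff.mpr fun e => ?_
  obtain ⟨e', rfl⟩ := Ext.contravariant_sequence_exact₃ (shortExact_of_linearMap hf hfg hg) _ e
    (extVanishes_iff.mp h₂ _) (add_zero 1)
  obtain ⟨φ, rfl⟩ := Ext.homEquiv₀.symm.surjective e'
  obtain ⟨ψ, hψ⟩ := h φ.hom
  -- The class is the pushout of the given extension along `φ`; as `φ` factors through `f`, which
  -- already kills the extension class, it is zero.
  have hφ : φ = ModuleCat.ofHom f ≫ ModuleCat.ofHom ψ := by
    rw [← ModuleCat.ofHom_comp, hψ]; rfl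
  rw [Ext.homEquiv₀_symm_apply, hφ, ← Ext.mk₀_comp_mk₀]
  exact (shortExact_of_linearMap hf hfg hg).extClass_comp_assoc _

/-- If `Ext^1(Z, X) = 0`, then the sequence splits: `X` is a retract of `Y`. -/
theorem exists_retraction (h : ExtVanishes A Z X 1) :
    ∃ r : Y →ₗ[A] X, r ∘ₗ f = LinearMap.id :=
  exists_extension hf hfg hg h LinearMap.id

end ShortExact

theorem prod_left {i : ℕ} (hX : ExtVanishes A X W i) (hY : ExtVanishes A Y W i) :
    ExtVanishes A (X × Y) W i :=
  left_middle (LinearMap.inl_injective (R := A)) Function.Exact.inl_snd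
    Prod.snd_surjective hX hY

theorem prod_right {i : ℕ} (hX : ExtVanishes A W X i) (hY : ExtVanishes A W Y i) :
    ExtVanishes A W (X × Y) i :=
  right_middle (LinearMap.inl_injective (R := A)) Function.Exact.inl_snd
    Prod.snd_surjective hX hY

theorem of_subsingleton_left [Subsingleton X] (i : ℕ) : ExtVanishes A X W i := by
  refine extVanishes_iff.mpr fun e => ?_
  rw [← e.mk₀_id_comp, (ModuleCat.isZero_of_subsingleton _).eq_of_src (𝟙 _) 0, Ext.mk₀_zero,
    Ext.zero_comp]

theorem of_subsingleton_right [Subsingleton X] (i : ℕ) : ExtVanishes A W X i := by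
  refine extVanishes_iff.mpr fun e => ?_
  rw [← e.comp_mk₀_id, (ModuleCat.isZero_of_subsingleton _).eq_of_src (𝟙 _) 0, Ext.mk₀_zero,
    Ext.comp_zero]

theorem fin_fun_left {i : ℕ} (h : ExtVanishes A X W i) (k : ℕ) :
    ExtVanishes A (Fin k → X) W i := by
  induction k with
  | zero => exact of_subsingleton_left i
  | succ k ih => exact (h.prod_left ih).of_linearEquiv_left (Fin.consLinearEquiv A fun _ => X).symm

theorem fin_fun_right {i : ℕ} (h : ExtVanishes A W X i) (k : ℕ) :
    ExtVanishes A W (Fin k → X) i := by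
  induction k with
  | zero => exact of_subsingleton_right i
  | succ k ih =>
    exact (h.prod_right ih).of_linearEquiv_right (Fin.consLinearEquiv A fun _ => X).symm

/-- `Hom(W, -)` is left exact: `Ext^0(W, X)` vanishes if `X` embeds in `Y` and `Ext^0(W, Y)`
vanishes. -/
theorem zero_of_injective {f : X →ₗ[A] Y} (hf : Function.Injective f)
    (h : ExtVanishes A W Y 0) : ExtVanishes A W X 0 := by
  have : Mono (ModuleCat.ofHom f) := (ModuleCat.mono_iff_injective _).mpr hf
  refine extVanishes_iff.mpr fun e => Ext.postcomp_mk₀_injective_of_mono _ (ModuleCat.ofHom f) ?_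
  rw [map_zero]
  exact extVanishes_iff.mp h _

end ExtVanishes

end ExtVanishing

end CohenMacaulayOrders

/-! ### The injective dimension of a Gorenstein local ring. -/

namespace CohenMacaulayOrders

open CategoryTheory Abelian

open Pointwise in
/-- Quotients by regular sequences of length `r` have no `Ext` in degrees beyond `r`, if the module
that one starts with has none in positive degrees. -/
theorem ExtVanishes.quotient_of_isWeaklyRegular {R : Type u} [CommRing R] {W : Type u}
    [AddCommGroup W] [Module R W] (rs : List R) : ∀ (M : Type u) [AddCommGroup M] [Module R M] (c : ℕ),
      (∀ i, c < i → ExtVanishes R M W i) → RingTheory.Sequence.IsWeaklyRegular M rs →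
      ∀ i, c + rs.length < i →
        ExtVanishes R (M ⧸ (Ideal.ofList rs • ⊤ : Submodule R M)) W i := by
  induction rs with
  | nil =>
    intro M _ _ c h _ i hi
    refine (h i (by simpa using hi)).of_linearEquiv_left (Submodule.quotEquivOfEqBot _ (by simp))
  | cons r rs ih =>
    intro M _ _ c h hreg i hi
    rw [RingTheory.Sequence.isWeaklyRegular_cons_iff] at hreg
    rw [List.length_cons] at hi
    refine (ih (QuotSMulTop r M) (c + 1) ?_ hreg.2 i (by omega)).of_linearEquiv_left
      (Submodule.quotOfListConsSMulTopEquivQuotSMulTopInner M r rs)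
    intro j hj
    obtain ⟨k, rfl⟩ := Nat.exists_eq_succ_of_ne_zero (by omega : j ≠ 0)
    exact ExtVanishes.left_last (f := LinearMap.lsmul R M r) hreg.1
      (LinearMap.exact_lsmul_mkQ_smul_top M r) (Submodule.mkQ_surjective _)
      (h k (by omega)) (h (k + 1) (by omega))

section LocalRing

variable {R : Type u} [CommRing R] [IsLocalRing R] [IsNoetherianRing R]

open IsLocalRing Pointwise

/-- Nakayama's lemma for `Ext`: if `x` is a nonzerodivisor on `M` lying in the maximal ideal, and
`Ext^(i+1)(M / xM, W) = 0`, then `Ext^i(M, W) = 0`. -/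
theorem ExtVanishes.of_quotSMulTop {M W : Type u} [AddCommGroup M] [Module R M]
    [AddCommGroup W] [Module R W] [Module.Finite R M] [Module.Finite R W] {x : R}
    (hx : x ∈ maximalIdeal R) (hreg : IsSMulRegular M x) {i : ℕ}
    (h : ExtVanishes R (QuotSMulTop x M) W (i + 1)) : ExtVanishes R M W i := by
  set E := Ext (ModuleCat.of R M) (ModuleCat.of R W) i
  have hfin : Module.Finite R E := ModuleCat.finite_ext R _ _ i
  -- Vanishing of `Ext^(i+1)(M/xM, W)` makes multiplication by `x` surjective on `Ext^i(M, W)`.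
  have htop : (⊤ : Submodule R E) ≤ Ideal.span {x} • ⊤ := by
    intro e _
    obtain ⟨(e' : E), he'⟩ := Ext.contravariant_sequence_exact₁
      (shortExact_of_linearMap (f := LinearMap.lsmul R M x) hreg
        (LinearMap.exact_lsmul_mkQ_smul_top M x) (Submodule.mkQ_surjective _))
      (ModuleCat.of R W) e (add_comm 1 i) (extVanishes_iff.mp h _)
    replace he' : (Ext.mk₀ (x • 𝟙 (ModuleCat.of R M))).comp e' (zero_add i) = e := he'
    rw [Ext.mk₀_smul, Ext.smul_comp, Ext.mk₀_id_comp] at he'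
    rw [Submodule.ideal_span_singleton_smul]
    exact ⟨e', trivial, he'⟩
  have hbot : (⊤ : Submodule R E) = ⊥ :=
    Submodule.eq_bot_of_le_smul_of_le_jacobson_bot _ _ hfin.fg_top htop
      ((Ideal.span_singleton_le_iff_mem _).mpr (by rwa [jacobson_eq_maximalIdeal _ bot_ne_top]))
  exact (Submodule.subsingleton_iff R).mp (subsingleton_of_bot_eq_top hbot.symm)

/-- Cutting by a weakly regular sequence of length `r` shifts the range in which `Ext` vanishes
by at most `r`. -/
theorem ExtVanishes.of_isWeaklyRegular {W : Type u} [AddCommGroup W] [Module R W]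
    [Module.Finite R W] {d : ℕ}
    (hd : ∀ (N : Type u) [AddCommGroup N] [Module R N], Module.Finite R N → ∀ i, d < i →
      ExtVanishes R N W i) (rs : List R) :
    ∀ (M : Type u) [AddCommGroup M] [Module R M], Module.Finite R M →
      (∀ r ∈ rs, r ∈ maximalIdeal R) → RingTheory.Sequence.IsWeaklyRegular M rs →
      ∀ i, d < i + rs.length → ExtVanishes R M W i := by
  induction rs with
  | nil => exact fun M _ _ hM _ _ i hi => hd M hM i hi
  | cons r rs ih =>
    intro M _ _ hM hmem hreg i hi
    rw [RingTheory.Sequence.isWeaklyRegular_cons_iff] at hreg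
    simp only [List.mem_cons, forall_eq_or_imp, List.length_cons] at hmem hi
    exact .of_quotSMulTop hmem.1 hreg.1 (ih _ inferInstance hmem.2 hreg.2 _ (by omega))

/-- If `Ext^(i+1)(N, W) = 0` for all finitely generated `N` and `Ext^i(k, W) = 0` for the residue
field `k`, then `Ext^i(N, W) = 0` for all finitely generated `N`. -/
theorem ExtVanishes.of_residueField {W : Type u} [AddCommGroup W] [Module R W] [Module.Finite R W]
    {i : ℕ} (hi : ∀ (N : Type u) [AddCommGroup N] [Module R N], Module.Finite R N →
      ExtVanishes R N W (i + 1)) (hk : ExtVanishes R (R ⧸ maximalIdeal R) W i)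
    (N : Type u) [AddCommGroup N] [Module R N] (hN : Module.Finite R N) :
    ExtVanishes R N W i := by
  induction hN using IsNoetherianRing.induction_on_isQuotientEquivQuotientPrime R with
  | subsingleton N => exact .of_subsingleton_left i
  | quotient N p e =>
    refine ExtVanishes.of_linearEquiv_left ?_ e
    by_cases hp : p.asIdeal = maximalIdeal R
    · rwa [hp]
    -- An element of the maximal ideal outside `p` is a nonzerodivisor on `R/p`, so Nakayama reduces
    -- to degree `i + 1`.
    · obtain ⟨x, hx, hxp⟩ := SetLike.exists_of_lt
        (lt_of_le_of_ne (le_maximalIdeal p.2.ne_top) hp)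
      refine .of_quotSMulTop hx ?_ (hi _ inferInstance)
      rw [isSMulRegular_quotient_iff_mem_of_smul_mem]
      exact fun y hy => (p.2.mem_or_mem hy).resolve_left hxp
  | exact N₁ N₂ N₃ f g hf hg hfg h₁ h₃ => exact .left_middle hf hfg hg h₁ h₃

/-- The residue field embeds in a nontrivial local ring quotient of dimension zero. -/
theorem exists_residueField_injective {I : Ideal R} (hI : ringKrullDim (R ⧸ I) = 0) :
    ∃ f : (R ⧸ maximalIdeal R) →ₗ[R] R ⧸ I, Function.Injective f := by
  have : Nontrivial (R ⧸ I) := by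
    by_contra h
    rw [not_nontrivial_iff_subsingleton] at h
    rw [ringKrullDim_eq_bot_of_subsingleton] at hI
    exact absurd hI (by simp)
  obtain ⟨p, hp⟩ := associatedPrimes.nonempty R (R ⧸ I)
  -- An associated prime of `R/I` contains `I`, and dimension zero forces it to be maximal.
  have hpm : p = maximalIdeal R := by
    have hIp : I ≤ p := by
      have := hp.annihilator_le
      rwa [Submodule.annihilator_top, Ideal.annihilator_quotient] at this
    have : Ring.KrullDimLE 0 (R ⧸ I) := by
      rw [Ring.krullDimLE_iff, hI]; rfl
    have hpp := hp.isPrime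
    have hprime : (p.map (Ideal.Quotient.mk I)).IsPrime :=
      Ideal.map_isPrime_of_surjective Ideal.Quotient.mk_surjective (by rwa [Ideal.mk_ker])
    have hmax := Ideal.isMaximal_of_isPrime (p.map (Ideal.Quotient.mk I))
    have := Ideal.comap_isMaximal_of_surjective _ Ideal.Quotient.mk_surjective (K := p.map (Ideal.Quotient.mk I))
    rw [Ideal.comap_map_of_surjective _ Ideal.Quotient.mk_surjective,
      ← RingHom.ker_eq_comap_bot, Ideal.mk_ker, sup_eq_left.mpr hIp] at this
    exact eq_maximalIdeal this
  subst hpm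
  exact ((isAssociatedPrime_iff_exists_injective_linearMap _ _).mp hp).2

variable {d : ℕ} (hd : ringKrullDim R = d)

include hd

/-- A Gorenstein local ring of dimension `d` and depth at least `d` has injective dimension at
most `d` (tested on finitely generated modules). -/
theorem extVanishes_of_ringKrullDim_lt (hinj : HasFiniteInjectiveDimension R R)
    (rs : List R) (hlen : rs.length = d) (hreg : RingTheory.Sequence.IsRegular R rs)
    (N : Type u) [AddCommGroup N] [Module R N] (hN : Module.Finite R N) {i : ℕ} (hi : d < i) :
    ExtVanishes R N R i := by
  obtain ⟨t, ht⟩ := hinj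
  have hdim : ringKrullDim (R ⧸ Ideal.ofList rs) = 0 := by
    have h := ringKrullDim_add_length_eq_ringKrullDim_of_isRegular rs hreg
    rw [hd, hlen] at h
    generalize ringKrullDim (R ⧸ Ideal.ofList rs) = a at h
    induction a with
    | bot => simp at h
    | coe a =>
      induction a with
      | top => exact absurd h (by exact_mod_cast (ENat.top_ne_natCast d))
      | coe a => norm_cast at h ⊢; omega
  obtain ⟨f, hf⟩ := exists_residueField_injective hdim
  -- Descending induction on `i`, starting beyond `t`. Since `Ext^(i+1)` vanishes, the embedding of
  -- the residue field in `R/(rs)` makes `Ext^i(k, R)` a quotient of `Ext^i(R/(rs), R)`, which is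
  -- zero for `i > d`.
  have key : ∀ j i, d < i → t < i + j → ∀ (N : Type u) [AddCommGroup N] [Module R N],
      Module.Finite R N → ExtVanishes R N R i := by
    intro j
    induction j with
    | zero => exact fun i _ hi N _ _ _ => .of_hasInjectiveDimensionLE ht hi
    | succ j ih =>
      intro i hdi hti N _ _ hN
      have hsucc := ih (i + 1) (by omega) (by omega)
      refine .of_residueField hsucc ?_ N hN
      refine .left_first hf (LinearMap.exact_map_mkQ_range f) (Submodule.mkQ_surjective _) ?_
        (hsucc _ inferInstance)
      refine ExtVanishes.of_linearEquiv_left (ExtVanishes.quotient_of_isWeaklyRegular rs R 0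
        (fun i hi => .of_projective hi) hreg.toIsWeaklyRegular i (by omega))
        (Submodule.quotEquivOfEq _ _ (by simp))
  exact key (t + 1) i hi (by omega) N hN

end LocalRing

end CohenMacaulayOrders

/-! ### Duality into `R` for Ext-acyclic modules. -/

namespace CohenMacaulayOrders

section Duality

variable (R : Type u) [CommRing R]

/-- Finitely generated `R`-modules `N` with `Ext_R^i(N, R) = 0` for all `i > 0`. -/
structure IsExtAcyclic (N : Type u) [AddCommGroup N] [Module R N] : Prop where
  finite : Module.Finite R N
  ext : ∀ i, 0 < i → ExtVanishes R N R i

variable {R}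

namespace IsExtAcyclic

theorem of_injective_exact_surjective {X Y Z : Type u} [AddCommGroup X] [Module R X]
    [AddCommGroup Y] [Module R Y] [AddCommGroup Z] [Module R Z] [IsNoetherianRing R]
    {f : X →ₗ[R] Y} {g : Y →ₗ[R] Z} (hf : Function.Injective f) (hfg : Function.Exact f g)
    (hg : Function.Surjective g) (hY : IsExtAcyclic R Y) (hZ : IsExtAcyclic R Z) :
    IsExtAcyclic R X :=
  have := hY.finite
  ⟨Module.Finite.of_injective f hf,
    fun i hi => .left_first hf hfg hg (hY.ext i hi) (hZ.ext (i + 1) (by omega))⟩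

theorem of_projective {P : Type u} [AddCommGroup P] [Module R P] [Module.Finite R P]
    [Module.Projective R P] : IsExtAcyclic R P :=
  ⟨inferInstance, fun _ hi => .of_projective hi⟩

theorem fin_fun {N : Type u} [AddCommGroup N] [Module R N] (hN : IsExtAcyclic R N) (k : ℕ) :
    IsExtAcyclic R (Fin k → N) :=
  have := hN.finite
  ⟨inferInstance, fun i hi => (hN.ext i hi).fin_fun_left k⟩

section

variable {N : Type u} [AddCommGroup N] [Module R N] {n : ℕ} {f : (Fin n → R) →ₗ[R] N}
  (hf : Function.Surjective f)

include hf

theorem ker [IsNoetherianRing R] (hN : IsExtAcyclic R N) : IsExtAcyclic R (LinearMap.ker f) :=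
  of_injective_exact_surjective (LinearMap.ker f).injective_subtype
    (LinearMap.exact_subtype_ker_map f) hf of_projective hN

theorem dualMap_subtype_surjective (hN : IsExtAcyclic R N) :
    Function.Surjective (LinearMap.ker f).subtype.dualMap := fun φ =>
  ExtVanishes.exists_extension (LinearMap.ker f).injective_subtype
    (LinearMap.exact_subtype_ker_map f) hf (hN.ext 1 one_pos) φ

theorem exact_dualMap : Function.Exact f.dualMap (LinearMap.ker f).subtype.dualMap := by
  intro φ
  constructor
  · intro h
    have hker : LinearMap.ker f ≤ LinearMap.ker φ := fun x hx =>
      LinearMap.congr_fun h (⟨x, hx⟩ : LinearMap.ker f)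
    refine ⟨(LinearMap.ker f).liftQ φ hker ∘ₗ (f.quotKerEquivOfSurjective hf).symm.toLinearMap, ?_⟩
    refine LinearMap.ext fun x => ?_
    have hx : (f.quotKerEquivOfSurjective hf).symm (f x) = Submodule.Quotient.mk x := by
      rw [LinearEquiv.symm_apply_eq]; rfl
    exact (congrArg ((LinearMap.ker f).liftQ φ hker) hx).trans
      (Submodule.liftQ_apply _ _ _)
  · rintro ⟨ψ, rfl⟩
    ext x
    exact (congrArg ψ x.2).trans (map_zero ψ)

end

section Gorenstein

variable [IsNoetherianRing R]

variable {d : ℕ} (hd : ∀ (N : Type u) [AddCommGroup N] [Module R N], Module.Finite R N →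
  ∀ i, d < i → ExtVanishes R N R i)

include hd

/-- Over a ring of finite injective dimension, the dual of an `Ext`-acyclic module is
`Ext`-acyclic. -/
theorem dual {N : Type u} [AddCommGroup N] [Module R N] (hN : IsExtAcyclic R N) :
    IsExtAcyclic R (Module.Dual R N) := by
  -- Descending induction on `i`: the dual sequence `0 → N* → (R^n)* → K* → 0`, with `K` the kernel
  -- of `R^n → N`, reduces degree `i` for `N*` to degree `i + 1` for `K*`.
  have key : ∀ j i, 0 < i → d < i + j → ∀ (N : Type u) [AddCommGroup N] [Module R N],
      IsExtAcyclic R N → ExtVanishes R (Module.Dual R N) R i := by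
    intro j
    induction j with
    | zero =>
      intro i _ hi N _ _ hN
      have := hN.finite
      exact hd _ inferInstance i hi
    | succ j ih =>
      intro i hi hij N _ _ hN
      have := hN.finite
      obtain ⟨n, f, hf⟩ := Module.Finite.exists_fin' R N
      exact .left_first (LinearMap.dualMap_injective_of_surjective hf) (exact_dualMap hf)
        (hN.dualMap_subtype_surjective hf) (.of_projective hi)
        (ih (i + 1) (by omega) (by omega) _ (hN.ker hf))
  have := hN.finite
  exact ⟨inferInstance, fun i hi => key (d + 1) i hi (by omega) N hN⟩

/-- Over a ring of finite injective dimension, the biduality map of an `Ext`-acyclic module is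
surjective. -/
theorem dual_eval_surjective {N : Type u} [AddCommGroup N] [Module R N] (hN : IsExtAcyclic R N) :
    Function.Surjective (Module.Dual.eval R N) := by
  intro η
  have := hN.finite
  obtain ⟨n, f, hf⟩ := Module.Finite.exists_fin' R N
  -- As `Ext^1(K*, R) = 0`, the functional extends from `N*` to `(R^n)*`, where it is evaluation at
  -- a vector.
  obtain ⟨ψ, hψ⟩ := ExtVanishes.exists_extension (LinearMap.dualMap_injective_of_surjective hf)
    (exact_dualMap hf) (hN.dualMap_subtype_surjective hf) (((hN.ker hf).dual hd).ext 1 one_pos) η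
  obtain ⟨u, rfl⟩ := (Module.bijective_dual_eval R (Fin n → R)).2 ψ
  exact ⟨f u, by rw [← hψ]; rfl⟩

/-- Over a ring of finite injective dimension, the biduality map of an `Ext`-acyclic module is
injective. -/
theorem dual_eval_injective {N : Type u} [AddCommGroup N] [Module R N] (hN : IsExtAcyclic R N) :
    Function.Injective (Module.Dual.eval R N) := by
  rw [injective_iff_map_eq_zero]
  intro c hc
  have := hN.finite
  obtain ⟨n, f, hf⟩ := Module.Finite.exists_fin' R N
  obtain ⟨u, rfl⟩ := hf c
  have hsurj := hN.dualMap_subtype_surjective hf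
  -- If `f u` is killed by all of `N*`, evaluation at `u` factors through `K*`. Surjectivity of
  -- biduality for `K` then represents it by an element of `K`, which must be `u`.
  have hker : LinearMap.ker (LinearMap.ker f).subtype.dualMap ≤
      LinearMap.ker (Module.Dual.eval R (Fin n → R) u) := by
    intro ψ hψ
    obtain ⟨φ, rfl⟩ := (exact_dualMap hf ψ).mp hψ
    exact LinearMap.congr_fun hc φ
  obtain ⟨k, hk⟩ := (hN.ker hf).dual_eval_surjective hd
    ((LinearMap.ker (LinearMap.ker f).subtype.dualMap).liftQ _ hker ∘ₗ
      ((LinearMap.ker f).subtype.dualMap.quotKerEquivOfSurjective hsurj).symm.toLinearMap)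
  have hku : (k : Fin n → R) = u := by
    apply (Module.bijective_dual_eval R (Fin n → R)).1
    refine LinearMap.ext fun ψ => ?_
    have h := LinearMap.congr_fun hk ((LinearMap.ker f).subtype.dualMap ψ)
    have hx : ((LinearMap.ker f).subtype.dualMap.quotKerEquivOfSurjective hsurj).symm
        ((LinearMap.ker f).subtype.dualMap ψ) = Submodule.Quotient.mk ψ := by
      rw [LinearEquiv.symm_apply_eq]; rfl
    exact h.trans ((congrArg (Submodule.liftQ _ _ hker) hx).trans (Submodule.liftQ_apply _ _ _))
  rw [← hku]
  exact k.2

end Gorenstein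

end IsExtAcyclic

end Duality

end CohenMacaulayOrders

/-! ### The canonical module as a relative injective cogenerator. -/

namespace CohenMacaulayOrders

section CanonicalModule

variable (R : Type u) [CommRing R] (Λ : Type u) [Ring Λ] [Algebra R Λ]

noncomputable instance CanonicalModule.instModuleBase : Module R (CanonicalModule R Λ) :=
  inferInstanceAs (Module R (Λ →ₗ[R] R))

instance CanonicalModule.instIsScalarTower : IsScalarTower R Λ (CanonicalModule R Λ) where
  smul_assoc r a f := LinearMap.ext fun x =>
    (congrArg (show Λ →ₗ[R] R from f) (mul_smul_comm r x a)).trans (map_smul _ r _)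

variable {Λ}

/-- Evaluation at `1`, as an `R`-linear map on the canonical module. -/
noncomputable def CanonicalModule.evalOne : CanonicalModule R Λ →ₗ[R] R :=
  Module.Dual.eval R Λ 1

variable {R}
variable {C : Type u} [AddCommGroup C] [Module R C] [Module Λ C] [IsScalarTower R Λ C]

/-- The `Λ`-linear map `C → Hom_R(Λ, R)` adjoint to an `R`-linear map `C → R`. -/
noncomputable def CanonicalModule.lift (φ : C →ₗ[R] R) : C →ₗ[Λ] CanonicalModule R Λ where
  toFun c := φ ∘ₗ (LinearMap.toSpanSingleton Λ C c).restrictScalars R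
  map_add' c c' := LinearMap.ext fun a =>
    (congrArg φ (smul_add a c c')).trans (map_add φ _ _)
  map_smul' b c := LinearMap.ext fun a => congrArg φ (smul_smul a b c)

theorem CanonicalModule.evalOne_lift (φ : C →ₗ[R] R) (c : C) :
    evalOne R (lift (Λ := Λ) φ c) = φ c :=
  congrArg φ (one_smul Λ c)

/-- Together with `evalOne_lift` this is the adjunction `Hom_Λ(C, ω) = Hom_R(C, R)`, through which
extension problems into `ω` become problems over `R`. -/
theorem CanonicalModule.lift_evalOne (Φ : C →ₗ[Λ] CanonicalModule R Λ) :
    lift (evalOne R ∘ₗ Φ.restrictScalars R) = Φ := by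
  refine LinearMap.ext fun c => LinearMap.ext fun a => ?_
  have h : evalOne R (Φ (a • c)) = evalOne R (a • Φ c) := congrArg _ (map_smul Φ a c)
  exact h.trans (congrArg (show Λ →ₗ[R] R from Φ c) (one_mul a))

/-- A finitely generated module is a quotient of a finite free `Λ`-module. -/
theorem exists_fin_fun_surjective [Module.Finite R C] :
    ∃ (n : ℕ) (π : (Fin n → Λ) →ₗ[Λ] C), Function.Surjective π := by
  have : Module.Finite Λ C := Module.Finite.of_restrictScalars_finite R Λ C
  exact Module.Finite.exists_fin' Λ C

/-- The quotient of an `Ext`-acyclic module by an `Ext`-acyclic submodule `C` is `Ext`-acyclic as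
soon as all linear forms extend from `C`. -/
theorem IsExtAcyclic.of_exists_extension {X Y Z : Type u} [AddCommGroup X] [Module R X]
    [AddCommGroup Y] [Module R Y] [AddCommGroup Z] [Module R Z]
    {f : X →ₗ[R] Y} {g : Y →ₗ[R] Z} (hf : Function.Injective f) (hfg : Function.Exact f g)
    (hg : Function.Surjective g) (hX : IsExtAcyclic R X) (hY : IsExtAcyclic R Y)
    (h : ∀ φ : X →ₗ[R] R, ∃ ψ : Y →ₗ[R] R, ψ ∘ₗ f = φ) : IsExtAcyclic R Z := by
  have := hY.finite
  refine ⟨Module.Finite.of_surjective g hg, fun i hi => ?_⟩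
  obtain ⟨i, rfl⟩ := Nat.exists_eq_succ_of_ne_zero hi.ne'
  cases i with
  | zero => exact .one_of_exists_extension hf hfg hg h (hY.ext 1 one_pos)
  | succ i => exact .left_last hf hfg hg (hX.ext (i + 1) i.succ_pos) (hY.ext (i + 2) (by omega))

theorem IsExtAcyclic.quotient_range {Y : Type u} [AddCommGroup Y] [Module R Y] [Module Λ Y]
    [IsScalarTower R Λ Y] {φ : C →ₗ[Λ] Y} (hφ : Function.Injective φ) (hC : IsExtAcyclic R C)
    (hY : IsExtAcyclic R Y)
    (h : ∀ χ : C →ₗ[R] R, ∃ ψ : Y →ₗ[R] R, ψ ∘ₗ φ.restrictScalars R = χ) :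
    IsExtAcyclic R (Y ⧸ LinearMap.range φ) := by
  have hf : Function.Injective (φ.restrictScalars R) := hφ
  have hg : Function.Surjective ((LinearMap.range φ).mkQ.restrictScalars R) :=
    fun x => Submodule.mkQ_surjective _ x
  have hfg : Function.Exact (φ.restrictScalars R) ((LinearMap.range φ).mkQ.restrictScalars R) :=
    fun x => LinearMap.exact_map_mkQ_range φ x
  exact .of_exists_extension hf hfg hg hC hY h

/-- For `b` generating the dual of `C`, every linear form extends along `C → ω^k`; this is what
makes the cokernel Ext-acyclic. -/
theorem CanonicalModule.exists_extension {k : ℕ} (b : Fin k → (C →ₗ[R] R)) (v : Fin k → R) :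
    ∃ ψ : (Fin k → CanonicalModule R Λ) →ₗ[R] R,
      ψ ∘ₗ (LinearMap.pi fun j => (lift (Λ := Λ) (b j)).restrictScalars R) = ∑ j, v j • b j := by
  refine ⟨∑ j, v j • (CanonicalModule.evalOne R ∘ₗ LinearMap.proj j), LinearMap.ext fun c => ?_⟩
  rw [LinearMap.comp_apply, LinearMap.sum_apply, LinearMap.sum_apply]
  refine Finset.sum_congr rfl fun j _ => ?_
  rw [LinearMap.smul_apply, LinearMap.smul_apply, LinearMap.comp_apply, LinearMap.proj_apply,
    LinearMap.pi_apply, LinearMap.restrictScalars_apply, evalOne_lift]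

theorem CanonicalModule.eq_zero_of_pi_lift_eq_zero {k : ℕ} (b : Fin k → (C →ₗ[R] R)) {c : C}
    (h : LinearMap.pi (fun j => lift (Λ := Λ) (b j)) c = 0) (j : Fin k) : b j c = 0 := by
  rw [← evalOne_lift (Λ := Λ) (b j) c]
  exact (congrArg (evalOne R) (congrFun h j)).trans (map_zero _)

variable [IsNoetherianRing R] (hΛ : IsExtAcyclic R Λ)

include hΛ

theorem IsExtAcyclic.kerOfFree {n : ℕ} {π : (Fin n → Λ) →ₗ[Λ] C} (hπ : Function.Surjective π)
    (hC : IsExtAcyclic R C) : IsExtAcyclic R (LinearMap.ker π) :=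
  .of_injective_exact_surjective (f := (LinearMap.ker π).subtype.restrictScalars R)
    (g := π.restrictScalars R) (LinearMap.ker π).injective_subtype
    (LinearMap.exact_subtype_ker_map π) hπ (hΛ.fin_fun n) hC

/-- `Ext_Λ^i(C, ω) = 0` for `i > 0` if `Ext_R^j(C, R) = 0` for all `j > 0`. -/
theorem IsExtAcyclic.extVanishes_canonicalModule (hC : IsExtAcyclic R C) {i : ℕ} (hi : 0 < i) :
    ExtVanishes Λ C (CanonicalModule R Λ) i := by
  obtain ⟨i, rfl⟩ := Nat.exists_eq_succ_of_ne_zero hi.ne'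
  induction i generalizing C with
  | zero =>
    have := hC.finite
    obtain ⟨n, π, hπ⟩ := exists_fin_fun_surjective (R := R) (Λ := Λ) (C := C)
    refine .one_of_exists_extension (LinearMap.ker π).injective_subtype
      (LinearMap.exact_subtype_ker_map π) hπ (fun Φ => ?_) (.of_projective one_pos)
    -- By adjunction, extending the corresponding `R`-linear form is enough.
    obtain ⟨ψ, hψ⟩ := ExtVanishes.exists_extension
      (f := (LinearMap.ker π).subtype.restrictScalars R) (g := π.restrictScalars R)
      (LinearMap.ker π).injective_subtype (LinearMap.exact_subtype_ker_map π) hπ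
      (hC.ext 1 one_pos) (CanonicalModule.evalOne R ∘ₗ Φ.restrictScalars R)
    refine ⟨CanonicalModule.lift ψ, ?_⟩
    rw [← CanonicalModule.lift_evalOne Φ, ← hψ]
    rfl
  | succ i ih =>
    have := hC.finite
    obtain ⟨n, π, hπ⟩ := exists_fin_fun_surjective (R := R) (Λ := Λ) (C := C)
    exact .left_last (LinearMap.ker π).injective_subtype (LinearMap.exact_subtype_ker_map π) hπ
      (ih (hΛ.kerOfFree hπ hC) i.succ_pos) (.of_projective (by omega))

variable {d : ℕ} (hd : ∀ (N : Type u) [AddCommGroup N] [Module R N], Module.Finite R N →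
  ∀ i, d < i → ExtVanishes R N R i)

include hd

theorem isExtAcyclic_canonicalModule : IsExtAcyclic R (CanonicalModule R Λ) :=
  hΛ.dual hd

/-- Every `Ext`-acyclic `Λ`-module embeds in a finite power of the canonical module, with an
`Ext`-acyclic cokernel. -/
theorem IsExtAcyclic.exists_injective_canonicalModule (hC : IsExtAcyclic R C) :
    ∃ (k : ℕ) (φ : C →ₗ[Λ] (Fin k → CanonicalModule R Λ)), Function.Injective φ ∧
      IsExtAcyclic R ((Fin k → CanonicalModule R Λ) ⧸ LinearMap.range φ) := by
  have := hC.finite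
  obtain ⟨k, p, hp⟩ := Module.Finite.exists_fin' R (Module.Dual R C)
  obtain ⟨b, hb⟩ : ∃ b : Fin k → (C →ₗ[R] R), ∀ v, p v = ∑ j, v j • b j :=
    ⟨fun j => p (Pi.single j 1), fun v => by
      conv_lhs => rw [pi_eq_sum_univ' v, map_sum]
      simp only [map_smul]⟩
  -- An element killed by the generators `b` is killed by the whole dual, hence is zero because
  -- biduality is injective.
  have hinj : Function.Injective (LinearMap.pi fun j => CanonicalModule.lift (Λ := Λ) (b j)) := by
    rw [injective_iff_map_eq_zero]
    intro c hc
    apply hC.dual_eval_injective hd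
    rw [map_zero]
    refine LinearMap.ext fun ψ => ?_
    obtain ⟨v, rfl⟩ := hp ψ
    rw [hb, Module.Dual.eval_apply, LinearMap.zero_apply, LinearMap.sum_apply]
    refine Finset.sum_eq_zero fun j _ => ?_
    rw [LinearMap.smul_apply, CanonicalModule.eq_zero_of_pi_lift_eq_zero b hc, smul_zero]
  have hext := CanonicalModule.exists_extension (Λ := Λ) b
  obtain ⟨φ, hφ⟩ : ∃ φ : C →ₗ[Λ] (Fin k → CanonicalModule R Λ),
    φ = LinearMap.pi fun j => CanonicalModule.lift (Λ := Λ) (b j) := ⟨_, rfl⟩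
  rw [← hφ] at hinj
  have hφR : φ.restrictScalars R =
      LinearMap.pi fun j => (CanonicalModule.lift (Λ := Λ) (b j)).restrictScalars R := by
    rw [hφ]; rfl
  rw [← hφR] at hext
  clear hφ hφR
  refine ⟨k, φ, hinj, .quotient_range hinj hC ((isExtAcyclic_canonicalModule hΛ hd).fin_fun k) ?_⟩
  intro ψ
  obtain ⟨v, rfl⟩ := hp ψ
  rw [hb]
  exact hext v

omit [Module R C] [IsScalarTower R Λ C] [Module Λ C] [AddCommGroup C] in
/-- If `C` has finite injective dimension relative to the `Ext`-acyclic modules, and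
`Ext_Λ^j(ω, C) = 0` for `j > 0`, then `C` is relatively injective. -/
theorem IsExtAcyclic.extVanishes_of_canonicalModule_pos {t : ℕ} :
    ∀ (C : Type u) [AddCommGroup C] [Module R C] [Module Λ C] [IsScalarTower R Λ C],
      IsExtAcyclic R C →
      (∀ (N : Type u) [AddCommGroup N] [Module R N] [Module Λ N] [IsScalarTower R Λ N],
        IsExtAcyclic R N → ∀ j, t < j → ExtVanishes Λ N C j) →
      (∀ j, 0 < j → ExtVanishes Λ (CanonicalModule R Λ) C j) →
      ∀ (N : Type u) [AddCommGroup N] [Module R N] [Module Λ N] [IsScalarTower R Λ N],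
        IsExtAcyclic R N → ∀ j, 0 < j → ExtVanishes Λ N C j := by
  induction t with
  | zero => exact fun _ _ _ _ _ _ h _ => h
  | succ t ih =>
    intro C _ _ _ _ hC hN hω N _ _ _ _ hNacyc
    obtain ⟨k, φ, hφ, hQ⟩ := hΛ.exists_injective_canonicalModule hd hC
    have hex := LinearMap.exact_map_mkQ_range φ
    have hsurj := Submodule.mkQ_surjective (LinearMap.range φ)
    have hωk : ∀ (N : Type u) [AddCommGroup N] [Module R N] [Module Λ N] [IsScalarTower R Λ N],
        IsExtAcyclic R N → ∀ (k j : ℕ), 0 < j →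
          ExtVanishes Λ N (Fin k → CanonicalModule R Λ) j :=
      fun N _ _ _ _ h k j hj => (hΛ.extVanishes_canonicalModule h hj).fin_fun_right k
    have hωacyc := isExtAcyclic_canonicalModule hΛ hd
    -- The cokernel `Q` of `C → ω^k` inherits the hypotheses with `t` in place of `t + 1`, so it is
    -- relatively injective.
    have hQv := ih _ hQ
      (fun N _ _ _ _ h j hj => .right_last hφ hex hsurj (hωk N h k j (by omega))
        (hN N h (j + 1) (by omega)))
      (fun j hj => .right_last hφ hex hsurj (hωk _ hωacyc k j hj) (hω (j + 1) (by omega)))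
    -- Hence `Q` is a summand of some `ω^l`. Then `Ext^1(Q, C) = 0` follows from `Ext^1(ω, C) = 0`,
    -- and `C` is itself a summand of `ω^k`.
    obtain ⟨l, χ, hχ, hQ'⟩ := hΛ.exists_injective_canonicalModule hd hQ
    obtain ⟨r, hr⟩ := ExtVanishes.exists_retraction hχ (LinearMap.exact_map_mkQ_range χ)
      (Submodule.mkQ_surjective _) (hQv _ hQ' 1 one_pos)
    obtain ⟨s, hs⟩ := ExtVanishes.exists_retraction hφ hex hsurj
      (((hω 1 one_pos).fin_fun_left l).of_retract_left χ r hr)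
    exact fun j hj => (hωk N hNacyc k j hj).of_retract_right φ s hs

/-- If `C` has finite injective dimension relative to the `Ext`-acyclic modules, and
`Ext_Λ^j(ω, C) = 0` for `j > n`, then this injective dimension is at most `n`. -/
theorem IsExtAcyclic.extVanishes_of_canonicalModule {t n : ℕ} :
    ∀ (C : Type u) [AddCommGroup C] [Module R C] [Module Λ C] [IsScalarTower R Λ C],
      IsExtAcyclic R C →
      (∀ (N : Type u) [AddCommGroup N] [Module R N] [Module Λ N] [IsScalarTower R Λ N],
        IsExtAcyclic R N → ∀ j, t < j → ExtVanishes Λ N C j) →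
      (∀ j, n < j → ExtVanishes Λ (CanonicalModule R Λ) C j) →
      ∀ (N : Type u) [AddCommGroup N] [Module R N] [Module Λ N] [IsScalarTower R Λ N],
        IsExtAcyclic R N → ∀ j, n < j → ExtVanishes Λ N C j := by
  induction n with
  | zero => exact IsExtAcyclic.extVanishes_of_canonicalModule_pos hΛ hd
  | succ n ih =>
    intro C _ _ _ _ hC hN hω N _ _ _ _ hNacyc j hj
    obtain ⟨k, φ, hφ, hQ⟩ := hΛ.exists_injective_canonicalModule hd hC
    have hex := LinearMap.exact_map_mkQ_range φ
    have hsurj := Submodule.mkQ_surjective (LinearMap.range φ)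
    have hωk : ∀ (N : Type u) [AddCommGroup N] [Module R N] [Module Λ N] [IsScalarTower R Λ N],
        IsExtAcyclic R N → ∀ j, 0 < j → ExtVanishes Λ N (Fin k → CanonicalModule R Λ) j :=
      fun N _ _ _ _ h j hj => (hΛ.extVanishes_canonicalModule h hj).fin_fun_right k
    have hωacyc := isExtAcyclic_canonicalModule hΛ hd
    have hωQ : ∀ j, n < j → ExtVanishes Λ (CanonicalModule R Λ) (_ ⧸ LinearMap.range φ) j := by
      intro j hj
      exact .right_last hφ hex hsurj (hωk _ hωacyc j (by omega)) (hω (j + 1) (by omega))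
    have hNQ : ∀ (N : Type u) [AddCommGroup N] [Module R N] [Module Λ N] [IsScalarTower R Λ N],
        IsExtAcyclic R N → ∀ j, t < j → ExtVanishes Λ N (_ ⧸ LinearMap.range φ) j := by
      intro N _ _ _ _ h j hj
      exact .right_last hφ hex hsurj (hωk N h j (by omega)) (hN N h (j + 1) (by omega))
    obtain ⟨j, rfl⟩ := Nat.exists_eq_succ_of_ne_zero (by omega : j ≠ 0)
    -- Passing to the cokernel lowers `n` by one; `t` may stay fixed, only its existence matters.
    exact .right_first hφ hex hsurj (ih _ hQ hNQ hωQ N hNacyc j (by omega))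
      (hωk N hNacyc (j + 1) (by omega))

end CanonicalModule

end CohenMacaulayOrders

/-! ### Stable annihilators and annihilators of Ext. -/

namespace CohenMacaulayOrders

open CategoryTheory Abelian

section StableAnnihilator

variable {R : Type u} [CommRing R]

variable {X Y Z W : Type u} [AddCommGroup X] [Module R X] [AddCommGroup Y] [Module R Y]
  [AddCommGroup Z] [Module R Z] [AddCommGroup W] [Module R W]

theorem comp_mem_projectiveHom {f : X →ₗ[R] Y} (hf : f ∈ projectiveHom R X Y) (g : W →ₗ[R] X)
    (h : Y →ₗ[R] Z) : h ∘ₗ f ∘ₗ g ∈ projectiveHom R W Z := by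
  obtain ⟨P, _, _, h₁, h₂, p, q, rfl⟩ := hf
  exact ⟨P, inferInstance, inferInstance, h₁, h₂, p ∘ₗ g, h ∘ₗ q, rfl⟩

theorem mem_stableAnnihilator {a : R} :
    a ∈ stableAnnihilator R X ↔ a • (LinearMap.id : X →ₗ[R] X) ∈ projectiveHom R X X := by
  rw [stableAnnihilator, Module.mem_annihilator]
  constructor
  · intro h
    have := h (Submodule.Quotient.mk LinearMap.id)
    rwa [← Submodule.Quotient.mk_smul, Submodule.Quotient.mk_eq_zero] at this
  · intro h φ
    obtain ⟨φ, rfl⟩ := Submodule.Quotient.mk_surjective _ φ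
    rw [← Submodule.Quotient.mk_smul, Submodule.Quotient.mk_eq_zero]
    have := comp_mem_projectiveHom h LinearMap.id φ
    rwa [LinearMap.comp_id, LinearMap.comp_smul, LinearMap.comp_id] at this

theorem stableAnnihilator_le_of_retract (f : X →ₗ[R] Y) (g : Y →ₗ[R] X)
    (hgf : g ∘ₗ f = LinearMap.id) : stableAnnihilator R Y ≤ stableAnnihilator R X := by
  intro a ha
  rw [mem_stableAnnihilator] at ha ⊢
  have := comp_mem_projectiveHom ha f g
  rwa [LinearMap.smul_comp, LinearMap.comp_smul, LinearMap.id_comp, hgf] at this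

theorem inf_stableAnnihilator_le_prod :
    stableAnnihilator R X ⊓ stableAnnihilator R Y ≤ stableAnnihilator R (X × Y) := by
  rintro a ⟨hX, hY⟩
  rw [SetLike.mem_coe, mem_stableAnnihilator] at hX hY
  rw [mem_stableAnnihilator]
  have := add_mem
    (comp_mem_projectiveHom hX (LinearMap.fst R X Y) (LinearMap.inl R X Y))
    (comp_mem_projectiveHom hY (LinearMap.snd R X Y) (LinearMap.inr R X Y))
  convert this using 1
  ext <;> simp

theorem stableAnnihilator_of_subsingleton [Subsingleton X] : stableAnnihilator R X = ⊤ := by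
  refine (Ideal.eq_top_iff_one _).mpr (mem_stableAnnihilator.mpr ?_)
  rw [Subsingleton.elim ((1 : R) • (LinearMap.id : X →ₗ[R] X)) 0]
  exact zero_mem _

theorem stableAnnihilator_le_fin_fun (k : ℕ) :
    stableAnnihilator R X ≤ stableAnnihilator R (Fin k → X) := by
  induction k with
  | zero => rw [stableAnnihilator_of_subsingleton (X := Fin 0 → X)]; exact le_top
  | succ k ih =>
    refine (le_inf le_rfl ih).trans (inf_stableAnnihilator_le_prod.trans ?_)
    exact stableAnnihilator_le_of_retract (Fin.consLinearEquiv R fun _ => X).symm.toLinearMap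
      (Fin.consLinearEquiv R fun _ => X).toLinearMap (LinearEquiv.comp_symm _)

variable (R X Y) in
/-- The annihilator of `Ext_R^i(X, Y)`. -/
noncomputable def extAnnihilator (i : ℕ) : Ideal R :=
  Module.annihilator R (Ext (ModuleCat.of R X) (ModuleCat.of R Y) i)

theorem mem_extAnnihilator {i : ℕ} {a : R} : a ∈ extAnnihilator R X Y i ↔
    ∀ e : Ext (ModuleCat.of R X) (ModuleCat.of R Y) i, a • e = 0 :=
  Module.mem_annihilator

/-- Multiplication by such an element factors through `Ext^i(P, Y) = 0` with `P` projective. -/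
theorem stableAnnihilator_le_extAnnihilator {i : ℕ} (hi : 0 < i) :
    stableAnnihilator R X ≤ extAnnihilator R X Y i := by
  intro a ha
  obtain ⟨P, _, _, _, _, g, h, hgh⟩ := mem_stableAnnihilator.mp ha
  refine mem_extAnnihilator.mpr fun e => ?_
  have hid : a • 𝟙 (ModuleCat.of R X) = ModuleCat.ofHom g ≫ ModuleCat.ofHom h :=
    ModuleCat.hom_ext hgh
  calc a • e = (Ext.mk₀ (a • 𝟙 (ModuleCat.of R X))).comp e (zero_add i) := by
        rw [Ext.mk₀_smul, Ext.smul_comp, Ext.mk₀_id_comp]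
    _ = 0 := by
        rw [hid, ← Ext.mk₀_comp_mk₀_assoc, extVanishes_iff.mp (.of_projective hi)
          ((Ext.mk₀ (ModuleCat.ofHom h)).comp e (zero_add i)), Ext.comp_zero]

theorem extAnnihilator_le_of_retract {i : ℕ} (f : X →ₗ[R] Y) (g : Y →ₗ[R] X)
    (hgf : g ∘ₗ f = LinearMap.id) : extAnnihilator R Y W i ≤ extAnnihilator R X W i := by
  intro a ha
  rw [mem_extAnnihilator] at ha ⊢
  intro e
  have hid : ModuleCat.ofHom f ≫ ModuleCat.ofHom g = 𝟙 (ModuleCat.of R X) := by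
    rw [← ModuleCat.ofHom_comp, hgf, ModuleCat.ofHom_id]
  rw [← e.mk₀_id_comp, ← hid, ← Ext.mk₀_comp_mk₀_assoc, ← Ext.comp_smul, ha, Ext.comp_zero]

section ShortExact

variable {f : X →ₗ[R] Y} {g : Y →ₗ[R] Z} (hf : Function.Injective f) (hfg : Function.Exact f g)
  (hg : Function.Surjective g)

include hf hfg hg

/-- For a class `e` on `Z`, the second factor kills its image on `Y`, so the multiple of `e` comes
from `Ext^i(X, W)`, where the first factor kills it. -/
theorem extAnnihilator_mul_le {i : ℕ} :
    extAnnihilator R X W i * extAnnihilator R Y W (i + 1) ≤ extAnnihilator R Z W (i + 1) := by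
  rw [Ideal.mul_le]
  intro a ha b hb
  rw [mem_extAnnihilator] at ha hb ⊢
  intro e
  obtain ⟨e', he'⟩ := Ext.contravariant_sequence_exact₃ (shortExact_of_linearMap hf hfg hg) _
    (b • e) (by rw [Ext.comp_smul]; exact hb _) (add_comm 1 i)
  rw [mul_smul, ← he', ← Ext.comp_smul]
  exact (congrArg (fun x => Ext.comp _ x _) (ha e')).trans (Ext.comp_zero _ _ _ _ _)

/-- Dimension shifting in the second variable. -/
theorem extAnnihilator_succ_le {i : ℕ} (h : ExtVanishes R W Y i) :
    extAnnihilator R W X (i + 1) ≤ extAnnihilator R W Z i := by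
  intro a ha
  rw [mem_extAnnihilator] at ha ⊢
  intro e
  obtain ⟨e', he'⟩ := Ext.covariant_sequence_exact₃ _ (shortExact_of_linearMap hf hfg hg) (a • e)
    rfl (by rw [Ext.smul_comp]; exact ha _)
  rw [← he', extVanishes_iff.mp h e', Ext.zero_comp]

/-- The obstruction to lifting `a • id` from `Z` to `Y` is `a` times the extension class; a lift
factors `a • id` through the projective module `Y`. -/
theorem extAnnihilator_one_le_stableAnnihilator [Module.Finite R Y] [Module.Projective R Y] :
    extAnnihilator R Z X 1 ≤ stableAnnihilator R Z := by
  intro a ha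
  rw [mem_extAnnihilator] at ha
  obtain ⟨e, he⟩ := Ext.covariant_sequence_exact₃ (ModuleCat.of R Z)
    (shortExact_of_linearMap hf hfg hg) (Ext.mk₀ (a • 𝟙 (ModuleCat.of R Z))) (zero_add 1)
    (by rw [Ext.mk₀_smul, Ext.smul_comp]; exact ha _)
  obtain ⟨ψ, rfl⟩ := Ext.homEquiv₀.symm.surjective e
  rw [Ext.homEquiv₀_symm_apply, Ext.mk₀_comp_mk₀] at he
  have h := congrArg ModuleCat.Hom.hom ((Ext.mk₀_bijective _ _).1 he)
  exact mem_stableAnnihilator.mpr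
    ⟨Y, inferInstance, inferInstance, inferInstance, inferInstance, ψ.hom, g, h.symm⟩

end ShortExact

variable [IsNoetherianRing R]

/-- If `M` is `Ext`-acyclic, then the stable annihilator of `M` contains the annihilator of
`Ext_R^(k+1)(M, W)` for a suitable module `W`, namely the `(k+1)`-st syzygy of `M`. -/
theorem IsExtAcyclic.exists_extAnnihilator_le {M : Type u} [AddCommGroup M] [Module R M]
    (hM : IsExtAcyclic R M) (k : ℕ) :
    ∃ (W : Type u) (_ : AddCommGroup W) (_ : Module R W), Module.Finite R W ∧
      extAnnihilator R M W (k + 1) ≤ stableAnnihilator R M := by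
  induction k with
  | zero =>
    have := hM.finite
    obtain ⟨n, f, hf⟩ := Module.Finite.exists_fin' R M
    exact ⟨LinearMap.ker f, inferInstance, inferInstance, inferInstance,
      extAnnihilator_one_le_stableAnnihilator (LinearMap.ker f).injective_subtype
        (LinearMap.exact_subtype_ker_map f) hf⟩
  | succ k ih =>
    obtain ⟨W, _, _, _, hW⟩ := ih
    obtain ⟨n, f, hf⟩ := Module.Finite.exists_fin' R W
    exact ⟨LinearMap.ker f, inferInstance, inferInstance, inferInstance,
      (extAnnihilator_succ_le (LinearMap.ker f).injective_subtype
        (LinearMap.exact_subtype_ker_map f) hf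
        ((hM.ext (k + 1) k.succ_pos).fin_fun_right n)).trans hW⟩

end StableAnnihilator

/-! ### Depth and Ext from the residue field. -/

section Depth

variable {R : Type u} [CommRing R] [IsLocalRing R]

open IsLocalRing

theorem support_residueField :
    Module.support R (R ⧸ maximalIdeal R) = PrimeSpectrum.zeroLocus (maximalIdeal R) := by
  rw [Module.support_eq_zeroLocus, Ideal.annihilator_quotient]

theorem maximalIdeal_smul_top_lt {M : Type u} [AddCommGroup M] [Module R M] [Module.Finite R M]
    [Nontrivial M] : maximalIdeal R • (⊤ : Submodule R M) < ⊤ :=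
  lt_top_iff_ne_top.mpr (Submodule.top_ne_ideal_smul_of_le_jacobson_annihilator
    (maximalIdeal_le_jacobson _)).symm

variable [IsNoetherianRing R]

theorem exists_isRegular_of_extVanishes {M : Type u} [AddCommGroup M] [Module R M]
    [Module.Finite R M] [Nontrivial M] {d : ℕ}
    (h : ∀ i < d, ExtVanishes R (R ⧸ maximalIdeal R) M i) :
    ∃ rs : List R, rs.length = d ∧ (∀ r ∈ rs, r ∈ maximalIdeal R) ∧
      RingTheory.Sequence.IsRegular M rs :=
  ModuleCat.exists_isRegular_of_exists_subsingleton_ext (maximalIdeal R) d (ModuleCat.of R M)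
    maximalIdeal_smul_top_lt (ModuleCat.of R (R ⧸ maximalIdeal R)) support_residueField h

variable {d : ℕ} (hd : ringKrullDim R = d)

include hd

/-- Maximal Cohen-Macaulay modules in terms of the vanishing of `Ext` from the residue field. -/
theorem isMCM_iff_extVanishes {M : Type u} [AddCommGroup M] [Module R M] :
    IsMCM R M ↔ Module.Finite R M ∧ ∀ i < d, ExtVanishes R (R ⧸ maximalIdeal R) M i := by
  constructor
  · intro h
    have := h.finite
    refine ⟨this, fun i hi => ?_⟩
    rcases subsingleton_or_nontrivial M with hM | hM
    · exact .of_subsingleton_right i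
    · have hdepth := h.dim_le_depth
      rw [hd, depth, if_neg (not_subsingleton M)] at hdepth
      have hdepth' : (d : ℕ∞) ≤ _ := WithBot.coe_le_coe.mp hdepth
      -- Depth is a supremum, so for each `i < d` a regular sequence longer than `i` is chosen
      -- separately.
      obtain ⟨⟨rs, hmem, hreg⟩, hrs⟩ :=
        lt_iSup_iff.mp (lt_of_lt_of_le (Nat.cast_lt.mpr hi) hdepth')
      exact ModuleCat.subsingleton_ext_of_exists_isRegular (maximalIdeal R)
        (ModuleCat.of R (R ⧸ maximalIdeal R)) support_residueField.le (ModuleCat.of R M)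
        maximalIdeal_smul_top_lt rs hmem hreg i (Nat.cast_lt.mp hrs)
  · rintro ⟨hfin, h⟩
    refine ⟨hfin, ?_⟩
    rw [hd]
    refine WithBot.coe_le_coe.mpr ?_
    rw [depth]
    split_ifs with hM
    · exact le_top
    · rw [not_subsingleton_iff_nontrivial] at hM
      obtain ⟨rs, hlen, hmem, hreg⟩ := exists_isRegular_of_extVanishes h
      exact le_iSup_of_le ⟨rs, hmem, hreg⟩ (by rw [hlen])

/-- Over a Gorenstein local ring, maximal Cohen-Macaulay modules are `Ext`-acyclic. -/
theorem IsMCM.isExtAcyclic (hinj : ∀ (N : Type u) [AddCommGroup N] [Module R N],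
      Module.Finite R N → ∀ i, d < i → ExtVanishes R N R i)
    {M : Type u} [AddCommGroup M] [Module R M] (hM : IsMCM R M) : IsExtAcyclic R M := by
  obtain ⟨hfin, h⟩ := (isMCM_iff_extVanishes hd).mp hM
  refine ⟨hfin, fun i hi => ?_⟩
  rcases subsingleton_or_nontrivial M with hM | hM
  · exact .of_subsingleton_left i
  · obtain ⟨rs, hlen, hmem, hreg⟩ := exists_isRegular_of_extVanishes h
    -- Cutting by `d` elements moves degree `i > 0` to `i + d`, beyond the injective dimension of
    -- `R`.
    exact .of_isWeaklyRegular hinj rs M hfin hmem hreg.toIsWeaklyRegular i (by omega)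

end Depth

end CohenMacaulayOrders

/-! ### Syzygies over `Λ`. -/

namespace CohenMacaulayOrders

open CategoryTheory

section Syzygy

variable {R : Type u} [CommRing R] [IsNoetherianRing R] {Λ : Type u} [Ring Λ] [Algebra R Λ]
  [Module.Finite R Λ]

/-- Existence of a `k`-th syzygy `X` of a finitely generated `Λ`-module `N`, together with its
effect on the vanishing of `Ext` over `Λ` and over `R` and on the annihilators of `Ext_R`. -/
theorem exists_syzygy (N : Type u) [AddCommGroup N] [Module R N] [Module Λ N]
    [IsScalarTower R Λ N] [Module.Finite R N] (k : ℕ) :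
    ∃ (X : Type u) (_ : AddCommGroup X) (_ : Module R X) (_ : Module Λ X) (_ : IsScalarTower R Λ X),
      Module.Finite R X ∧
      (∀ (j : ℕ), 0 < j → (ExtVanishes Λ X Λ j ↔ ExtVanishes Λ N Λ (j + k))) ∧
      (IsExtAcyclic R Λ → ∀ (j : ℕ), 0 < j → ExtVanishes R N R (j + k) → ExtVanishes R X R j) ∧
      (∀ (K : Type u) [AddCommGroup K] [Module R K] (i : ℕ), i < k →
        (∀ j ≤ i, ExtVanishes R K Λ j) → ExtVanishes R K X i) ∧
      (∀ (Y : Type u) [AddCommGroup Y] [Module R Y] (j : ℕ), 0 < j →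
        extAnnihilator R X Y j * stableAnnihilator R Λ ^ k ≤ extAnnihilator R N Y (j + k)) := by
  induction k with
  | zero =>
    refine ⟨N, inferInstance, inferInstance, inferInstance, inferInstance, inferInstance,
      fun j _ => Iff.rfl, fun _ j _ h => h, fun K _ _ i hi => absurd hi i.not_lt_zero,
      fun Y _ _ j _ => ?_⟩
    rw [pow_zero, mul_one, add_zero]
  | succ k ih =>
    obtain ⟨X, _, _, _, _, _, h₁, h₂, h₃, h₄⟩ := ih
    obtain ⟨n, π, hπ⟩ := exists_fin_fun_surjective (R := R) (Λ := Λ) (C := X)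
    have hinj := (LinearMap.ker π).injective_subtype
    have hex := LinearMap.exact_subtype_ker_map π
    have hinjR : Function.Injective ((LinearMap.ker π).subtype.restrictScalars R) :=
      fun x y h => hinj h
    have hexR : Function.Exact ((LinearMap.ker π).subtype.restrictScalars R)
      (π.restrictScalars R) := fun x => hex x
    have hπR : Function.Surjective (π.restrictScalars R) := fun x => hπ x
    have hfin : Module.Finite R (LinearMap.ker π) := Module.Finite.of_injective _ hinjR
    refine ⟨LinearMap.ker π, inferInstance, inferInstance, inferInstance, inferInstance, hfin,
      fun j hj => ?_, fun hΛ j hj hN => ?_, fun K _ _ i hi hK => ?_, fun Y _ _ j hj => ?_⟩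
    · rw [add_comm k 1, ← add_assoc, ← h₁ (j + 1) j.succ_pos]
      exact ⟨fun h => .left_last hinj hex hπ h (.of_projective j.succ_pos),
        fun h => .left_first hinj hex hπ (.of_projective hj) h⟩
    · refine .left_first hinjR hexR hπR ((hΛ.ext j hj).fin_fun_left n)
        (h₂ hΛ (j + 1) j.succ_pos ?_)
      rwa [add_right_comm, add_assoc]
    · cases i with
      -- In degree zero no earlier term of the long exact sequence exists; left exactness of Hom
      -- replaces it.
      | zero => exact .zero_of_injective hinjR ((hK 0 le_rfl).fin_fun_right n)
      | succ i =>
        exact .right_first hinjR hexR hπR (h₃ K i (by omega) fun j hj => hK j (by omega))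
          ((hK (i + 1) le_rfl).fin_fun_right n)
    · have hle : stableAnnihilator R Λ ≤ extAnnihilator R (Fin n → Λ) Y (j + 1) :=
        (stableAnnihilator_le_fin_fun n).trans (stableAnnihilator_le_extAnnihilator j.succ_pos)
      calc extAnnihilator R (LinearMap.ker π) Y j * stableAnnihilator R Λ ^ (k + 1)
          = extAnnihilator R (LinearMap.ker π) Y j * stableAnnihilator R Λ *
            stableAnnihilator R Λ ^ k := by rw [pow_succ', mul_assoc]
        _ ≤ extAnnihilator R X Y (j + 1) * stableAnnihilator R Λ ^ k :=
            Ideal.mul_mono_left ((Ideal.mul_mono_right hle).trans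
              (extAnnihilator_mul_le hinjR hexR hπR))
        _ ≤ extAnnihilator R N Y (j + (k + 1)) := by
            have := h₄ Y (j + 1) j.succ_pos
            rwa [add_right_comm, add_assoc] at this

/-- A finitely generated module of finite projective dimension with `Ext_Λ^j(X, Λ) = 0` for all
`j > 0` is a direct summand of a finite free module. -/
theorem exists_retract_fin_fun {X : Type u} [AddCommGroup X] [Module R X] [Module Λ X]
    [IsScalarTower R Λ X] [Module.Finite R X] {p : ℕ}
    (hp : HasProjectiveDimensionLE (ModuleCat.of Λ X) p)
    (hX : ∀ j, 0 < j → ExtVanishes Λ X Λ j) :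
    ∃ (n : ℕ) (s : X →ₗ[Λ] (Fin n → Λ)) (π : (Fin n → Λ) →ₗ[Λ] X), π ∘ₗ s = LinearMap.id := by
  -- Descending induction on `j` from the projective dimension: since `Ext^j(X, Λ^n) = 0`, vanishing
  -- for `W` in degree `j` follows from vanishing for a syzygy of `W` in degree `j + 1`. Applied to
  -- `ker π` in degree one, this splits `π`.
  have key : ∀ q j, 0 < j → p < j + q → ∀ (W : Type u) [AddCommGroup W] [Module R W] [Module Λ W]
      [IsScalarTower R Λ W], Module.Finite R W → ExtVanishes Λ X W j := by
    intro q
    induction q with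
    | zero => exact fun j _ hj W _ _ _ _ _ => .of_hasProjectiveDimensionLE hp hj
    | succ q ih =>
      intro j hj hpj W _ _ _ _ _
      obtain ⟨n, π, hπ⟩ := exists_fin_fun_surjective (R := R) (Λ := Λ) (C := W)
      have hfin : Module.Finite R (LinearMap.ker π) :=
        Module.Finite.of_injective ((LinearMap.ker π).subtype.restrictScalars R)
          fun x y h => (LinearMap.ker π).injective_subtype h
      exact .right_last (LinearMap.ker π).injective_subtype (LinearMap.exact_subtype_ker_map π) hπ
        ((hX j hj).fin_fun_right n) (ih (j + 1) (by omega) (by omega) _ hfin)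
  obtain ⟨n, π, hπ⟩ := exists_fin_fun_surjective (R := R) (Λ := Λ) (C := X)
  have hfin : Module.Finite R (LinearMap.ker π) :=
    Module.Finite.of_injective ((LinearMap.ker π).subtype.restrictScalars R)
      fun x y h => (LinearMap.ker π).injective_subtype h
  obtain ⟨s, hs⟩ := ExtVanishes.exists_lift (LinearMap.ker π).injective_subtype
    (LinearMap.exact_subtype_ker_map π) hπ (key p 1 one_pos (by omega) _ hfin) LinearMap.id
  exact ⟨n, s, π, hs⟩

end Syzygy

/-! ### The theorem. -/

section Main

variable {R : Type u} [CommRing R]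

open scoped TensorProduct in
theorem exists_retract_tensorProduct {Λ : Type u} [Ring Λ] [Algebra R Λ]
    (hsplit : IsSplitStructureMap R Λ) (M : Type u) [AddCommGroup M] [Module R M] :
    ∃ (f : M →ₗ[R] Λ ⊗[R] M) (g : Λ ⊗[R] M →ₗ[R] M), g ∘ₗ f = LinearMap.id := by
  obtain ⟨s, hs⟩ := hsplit
  refine ⟨TensorProduct.mk R Λ M 1, (TensorProduct.lid R M).toLinearMap ∘ₗ s.rTensor M, ?_⟩
  have h1 : s 1 = 1 := by simpa using LinearMap.congr_fun hs 1
  ext m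
  simp [h1]

variable [IsLocalRing R]

/-- The injective dimension of a Gorenstein local ring that is a direct summand of a maximal
Cohen-Macaulay module is at most its dimension. -/
theorem IsMCM.extVanishes_of_isSplitStructureMap (hR : IsGorensteinLocalRing R) {d : ℕ}
    (hd : ringKrullDim R = d) {Λ : Type u} [Ring Λ] [Algebra R Λ]
    (hsplit : IsSplitStructureMap R Λ) (hΛ : IsMCM R Λ)
    (N : Type u) [AddCommGroup N] [Module R N] (hN : Module.Finite R N) (i : ℕ) (hi : d < i) :
    ExtVanishes R N R i := by
  have := hR.isNoetherianRing
  obtain ⟨s, hs⟩ := hsplit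
  -- The regular sequence of length `d` in `R` comes from `Λ`: as a summand of `Λ`, `R` inherits the
  -- vanishing of Ext from the residue field below `d`.
  obtain ⟨rs, hlen, -, hreg⟩ := exists_isRegular_of_extVanishes (M := R) (d := d) fun i hi =>
    (((isMCM_iff_extVanishes hd).mp hΛ).2 i hi).of_retract_right _ s hs
  exact extVanishes_of_ringKrullDim_lt hd hR.finite_injectiveDimension rs hlen hreg N hN hi

/-- The construction behind the theorem: a maximal Cohen-Macaulay syzygy `X` of `Λ ⊗ M`, whose
direct sum with `Λ` controls the stable annihilator of `M`. -/
theorem IsCanonicalOrder.exists_syzygy (hR : IsGorensteinLocalRing R) {d : ℕ}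
    (hd : ringKrullDim R = d) {Λ : Type u} [Ring Λ] [Algebra R Λ]
    (hsplit : IsSplitStructureMap R Λ) {M : Type u} [AddCommGroup M] [Module R M]
    (hM : IsMCM R M) {n : ℕ} (hΛ : IsCanonicalOrder R Λ n) :
    ∃ (X : Type u) (_ : AddCommGroup X) (_ : Module R X) (_ : Module Λ X) (_ : IsScalarTower R Λ X),
      IsMCM R X ∧ (∀ j, 0 < j → ExtVanishes Λ X Λ j) ∧
      (stableAnnihilator R X ⊓ stableAnnihilator R Λ) ^ (d + n + 1) ≤ stableAnnihilator R M := by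
  have := hR.isNoetherianRing
  have hinj := IsMCM.extVanishes_of_isSplitStructureMap hR hd hsplit hΛ.isMCM
  have hΛacyc := hΛ.isMCM.isExtAcyclic hd hinj
  obtain ⟨hΛfin, hΛdepth⟩ := (isMCM_iff_extVanishes hd).mp hΛ.isMCM
  have hMacyc := hM.isExtAcyclic hd hinj
  have hMfin := hM.finite
  obtain ⟨t, ht⟩ := hΛ.left_injectiveDimension
  have hpd : HasProjectiveDimensionLE (ModuleCat.of Λ (CanonicalModule R Λ)) n :=
    (projectiveDimension_le_iff _ n).mp hΛ.projectiveDimension_eq.le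
  have hacyc : ∀ (N : Type u) [AddCommGroup N] [Module R N] [Module Λ N] [IsScalarTower R Λ N],
      IsExtAcyclic R N → ∀ j, n < j → ExtVanishes Λ N Λ j :=
    IsExtAcyclic.extVanishes_of_canonicalModule hΛacyc hinj (t := t) Λ hΛacyc
      (fun N _ _ _ _ _ j hj => .of_hasInjectiveDimensionLE ht hj)
      (fun j hj => .of_hasProjectiveDimensionLE hpd hj)
  -- `Λ ⊗ M` need not be Ext-acyclic over `R`, but its `d`-th syzygy `Z` is, so `hacyc` applies to
  -- `Z`.
  have hvanish : ∀ j, 0 < j → ExtVanishes Λ (TensorProduct R Λ M) Λ (j + (d + n)) := by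
    obtain ⟨Z, _, _, _, _, hZfin, h₁, h₂, -, -⟩ :=
      CohenMacaulayOrders.exists_syzygy (R := R) (Λ := Λ) (TensorProduct R Λ M) d
    intro j hj
    have hZ : IsExtAcyclic R Z :=
      ⟨hZfin, fun i hi => h₂ hΛacyc i hi (hinj _ inferInstance _ (by omega))⟩
    have := (h₁ (j + n) (by omega)).mp (hacyc Z hZ (j + n) (by omega))
    rwa [add_assoc, add_comm n d] at this
  obtain ⟨X, _, _, _, _, hXfin, h₁, -, h₃, h₄⟩ :=
    CohenMacaulayOrders.exists_syzygy (R := R) (Λ := Λ) (TensorProduct R Λ M) (d + n)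
  refine ⟨X, inferInstance, inferInstance, inferInstance, inferInstance,
    (isMCM_iff_extVanishes hd).mpr ⟨hXfin, fun i hi => h₃ _ i (by omega) fun j hj =>
      hΛdepth j (by omega)⟩, fun j hj => (h₁ j hj).mpr (hvanish j hj), ?_⟩
  obtain ⟨W, _, _, -, hW⟩ := hMacyc.exists_extAnnihilator_le (d + n)
  obtain ⟨f, g, hgf⟩ := exists_retract_tensorProduct hsplit M
  calc (stableAnnihilator R X ⊓ stableAnnihilator R Λ) ^ (d + n + 1)
      -- One of the `d + n + 1` factors is spent on `X`, the others on the free modules of the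
      -- resolution.
      ≤ extAnnihilator R X W 1 * stableAnnihilator R Λ ^ (d + n) := by
        rw [pow_succ']
        exact Ideal.mul_mono (inf_le_left.trans (stableAnnihilator_le_extAnnihilator one_pos))
          (Ideal.pow_right_mono inf_le_right _)
    _ ≤ extAnnihilator R (TensorProduct R Λ M) W (d + n + 1) := by
        rw [add_comm (d + n) 1]
        exact h₄ W 1 one_pos
    _ ≤ extAnnihilator R M W (d + n + 1) := extAnnihilator_le_of_retract f g hgf
    _ ≤ stableAnnihilator R M := hW

/-- Adding the summand `Λ` to `X` places the stable annihilator inside those of both `X` and `Λ`. -/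
theorem IsCanonicalOrder.mcmMeetsCl (hR : IsGorensteinLocalRing R) {d : ℕ}
    (hd : ringKrullDim R = d) {Λ : Type u} [Ring Λ] [Algebra R Λ]
    (hsplit : IsSplitStructureMap R Λ) {M : Type u} [AddCommGroup M] [Module R M]
    (hM : IsMCM R M) {n : ℕ} (hΛ : IsCanonicalOrder R Λ n) : MCMMeetsCl R Λ (d + n + 1) M := by
  have := hR.isNoetherianRing
  obtain ⟨X, _, _, _, _, hX, hXΛ, hle⟩ := hΛ.exists_syzygy hR hd hsplit hM
  have hXfin := hX.finite
  have hΛfin := hΛ.isMCM.finite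
  have hX' := (isMCM_iff_extVanishes hd).mp hX
  have hΛ' := (isMCM_iff_extVanishes hd).mp hΛ.isMCM
  refine ⟨X × Λ, inferInstance, inferInstance, inferInstance, inferInstance,
    ⟨Module.Finite.of_restrictScalars_finite R Λ (X × Λ),
      fun i hi => (hXΛ i hi).prod_left (.of_projective hi)⟩,
    (isMCM_iff_extVanishes hd).mpr ⟨inferInstance, fun i hi =>
      (hX'.2 i hi).prod_right (hΛ'.2 i hi)⟩, ?_⟩
  refine (Ideal.pow_right_mono (le_inf ?_ ?_) _).trans hle
  · exact stableAnnihilator_le_of_retract (LinearMap.inl R X Λ) (LinearMap.fst R X Λ)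
      (LinearMap.fst_comp_inl R X Λ)
  · exact stableAnnihilator_le_of_retract (LinearMap.inr R X Λ) (LinearMap.snd R X Λ)
      (LinearMap.snd_comp_inr R X Λ)

/-- Finite global dimension makes `X` a summand of a finite free `Λ`-module, so the stable
annihilator of `Λ` already lies in that of `X`. -/
theorem IsNonsingularOrder.memCl (hR : IsGorensteinLocalRing R) {d : ℕ}
    (hd : ringKrullDim R = d) {Λ : Type u} [Ring Λ] [Algebra R Λ]
    (hsplit : IsSplitStructureMap R Λ) {M : Type u} [AddCommGroup M] [Module R M]
    (hM : IsMCM R M) (hΛ : IsNonsingularOrder R Λ) : MemCl R M (d + 1) Λ := by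
  have := hR.isNoetherianRing
  obtain ⟨X, _, _, _, _, hX, hXΛ, hle⟩ :=
    IsCanonicalOrder.exists_syzygy hR hd hsplit hM hΛ.isGorensteinOrder
  have hXfin := hX.finite
  have hΛfin := hΛ.isGorensteinOrder.isMCM.finite
  obtain ⟨p, hp⟩ := hΛ.finite_globalDimension
  obtain ⟨n, s, π, hs⟩ := exists_retract_fin_fun (R := R) (hp (ModuleCat.of Λ X)) hXΛ
  refine ⟨hΛ.isGorensteinOrder.isMCM, (Ideal.pow_right_mono (le_inf ?_ le_rfl) _).trans hle⟩
  exact (stableAnnihilator_le_fin_fun n).trans (stableAnnihilator_le_of_retract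
    (s.restrictScalars R) (π.restrictScalars R) (LinearMap.ext fun x => LinearMap.congr_fun hs x))

end Main

end CohenMacaulayOrders

theorem theorem4p13 {R : Type u} [CommRing R] [IsLocalRing R]
    (hR : CohenMacaulayOrders.IsGorensteinLocalRing R) (d : ℕ) (hd : ringKrullDim R = d)
    (Λ : Type u) [Ring Λ] [Algebra R Λ]
    (hsplit : CohenMacaulayOrders.IsSplitStructureMap R Λ)
    (M : Type u) [AddCommGroup M] [Module R M] (hM : CohenMacaulayOrders.IsMCM R M) :
    (∀ n : ℕ, CohenMacaulayOrders.IsCanonicalOrder R Λ n →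
      CohenMacaulayOrders.MCMMeetsCl R Λ (d + n + 1) M) ∧
    (CohenMacaulayOrders.IsGorensteinOrder R Λ →
      CohenMacaulayOrders.MCMMeetsCl R Λ (d + 1) M) ∧
    (CohenMacaulayOrders.IsNonsingularOrder R Λ →
      CohenMacaulayOrders.MemCl R M (d + 1) Λ) :=
  ⟨fun _ h => h.mcmMeetsCl hR hd hsplit hM,
    fun h => CohenMacaulayOrders.IsCanonicalOrder.mcmMeetsCl hR hd hsplit hM h,
    fun h => h.memCl hR hd hsplit hM⟩
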